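/- Let $G,H$ be locally compact (Hausdorff) groups, and let $G_\infty$ be the one-point compactification of $G$ if $G$ is not compact, and the disjoint union $G\sqcup\{\infty\}$ if $G$ is compact. A coset of a group is a left coset $sK$ of some subgroup $K$; a map $f$ from a coset $C\subseteq H$ to $G$ is affine if $f(rs^{-1}t)=f(r)f(s)^{-1}f(t)$ for all $r,s,t\in C$. For non-empty $A\subseteq H$, $\operatorname{aff}(A)$ is the smallest coset containing $A$. The coset ring $\Omega(H)$ is the smallest family of subsets of $H$ which contains all cosets of all subgroups and is closed under finite unions, finite intersections and complements. (Subgroups here need not be closed.) Let $\alpha:H\to G_\infty$ be continuous, put $Y=\alpha^{-1}(G)$, and suppose that $\alpha|_Y:Y\to G$ is piecewise affine, that is, $Y$ is a finite disjoint union of sets $Y_1,\dots,Y_k\in\Omega(H)$ such that for each $i$ with $Y_i\neq\emptyset$ there is an affine map $\operatorname{aff}(Y_i)\to G$ which agrees with $\alpha$ on $Y_i$. Then $Y$ is clopen in $H$. Furthermore, $Y$ is the disjoint union of finitely many (possibly zero) sets $L_1,\dots,L_n$ of the form $$L_i=E^{(i)}_0\setminus\bigcup_{j=1}^{m_i}E^{(i)}_j,\qquad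 m_i\ge 0,$$ where every $E^{(i)}_j$ ($0\le j\le m_i$) is a Borel coset in $H$, and for $j\geq 1$ one has $E^{(i)}_j\subseteq E^{(i)}_0$ and $E^{(i)}_j$ has infinite index in $E^{(i)}_0$; and for each $i$ there is a continuous affine map $\overline\alpha_i:\overline{E^{(i)}_0}\to G$ which agrees with $\alpha$ on $L_i$. -/

import Mathlib

open scoped Pointwise

/-- A coset of a group: a left coset `s K` of some subgroup `K`.
(Right cosets `K s = s (s⁻¹ K s)` are left cosets of another subgroup.) -/
def IsCoset {G : Type*} [Group G] (C : Set G) : Prop :=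
  ∃ (s : G) (K : Subgroup G), C = s • (K : Set G)

/-- `E` is a coset contained in the coset `E₀` and has infinite index in it:
`E = s K`, `E₀ = t K₀` with `E ⊆ E₀` (so that `K ≤ K₀`), and `[K₀ : K] = ∞`.
Mathlib's `relIndex` takes the value `0` exactly when the index is infinite. -/
def IsInfiniteIndexSubcoset {G : Type*} [Group G] (E E₀ : Set G) : Prop :=
  E ⊆ E₀ ∧ ∃ (s t : G) (K K₀ : Subgroup G),
    E = s • (K : Set G) ∧ E₀ = t • (K₀ : Set G) ∧ K.relIndex K₀ = 0

/-- The coset ring `Ω(G)`: the smallest collection of subsets of `G`, closed under finite unions,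
finite intersections and complements, which contains all cosets of all subgroups of `G`. -/
def cosetRing (G : Type*) [Group G] : BooleanSubalgebra (Set G) :=
  BooleanSubalgebra.closure {C : Set G | IsCoset C}

/-- `aff(A)`, the smallest coset containing `A`, as the intersection of all cosets containing `A`.
(For nonempty `A` this is a coset; for `A = ∅` there is in general no smallest coset,
and no condition is then imposed on an affine map where this is used below.) -/
def affHull {G : Type*} [Group G] (A : Set G) : Set G :=
  ⋂₀ {C : Set G | IsCoset C ∧ A ⊆ C}

/-- `f` is affine on the coset `C`: `f (r s⁻¹ t) = f(r) f(s)⁻¹ f(t)` for `r, s, t ∈ C`.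
Only the values of `f` on `C` matter. -/
def IsAffineOn {H G : Type*} [Group H] [Group G] (f : H → G) (C : Set H) : Prop :=
  ∀ r ∈ C, ∀ s ∈ C, ∀ t ∈ C, f (r * s⁻¹ * t) = f r * (f s)⁻¹ * f t

/-- `α : Y ⊆ H → G` is piecewise affine (a purely algebraic notion): `Y` is a finite disjoint union
of sets `Y i ∈ Ω(H)`, and on each `Y i` the map `α` agrees with an affine map on `aff(Y i)`. -/
def IsPiecewiseAffine {H G : Type*} [Group H] [Group G] {Y : Set H} (α : Y → G) : Prop :=
  ∃ (n : ℕ) (P : Fin n → Set H) (φ : Fin n → H → G),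
    (∀ i, P i ∈ cosetRing H) ∧
    Pairwise (Function.onFun Disjoint P) ∧
    Y = ⋃ i, P i ∧
    ∀ i, IsAffineOn (φ i) (affHull (P i)) ∧ ∀ y : Y, (y : H) ∈ P i → α y = φ i y

/-! ### Coset combinatorics: Neumann's lemma and normal forms in coset rings. -/

section Cosets

variable {H : Type*} [Group H]

/-! `Y` is open because `G` is open in `OnePoint G`. The rest uses Neumann's lemma: finitely many
cosets of infinite index never matter in a finite cover of a coset.

Every member of the coset ring is a finite disjoint union of reduced differences `L`, each a coset
`E` minus finitely many subcosets of infinite index. By Neumann, a coset containing `L` contains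
`E`, so the given affine map lives on all of `E`. It is continuous on `L`, and a second use of
Neumann makes it uniformly continuous on `E`; local compactness of `G` then extends it to a
continuous affine map on `closure E` (`IsReducedDiff.exists_continuous_affine_extension`). By
continuity `αInf` equals this extension on `closure L`, so `closure L ⊆ Y`, and `Y` is a finite
union of closed sets.

The cosets `E` need not be Borel. However, some `B` in the Boolean algebra of closed cosets
satisfies `L ⊆ B ⊆ closure L` (`exists_closedCosetRing_between`). The sets `B` cover `Y`, and
decomposing them into reduced differences of closed cosets gives the required pieces. -/

theorem leftCoset_eq_of_mem {K : Subgroup H} {g x : H} (h : x ∈ g • (K : Set H)) :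
    g • (K : Set H) = x • (K : Set H) :=
  (leftCoset_eq_iff K).2 ((mem_leftCoset_iff g).1 h)

theorem leftCoset_inter_eq {K L : Subgroup H} {a b z : H} (ha : z ∈ a • (K : Set H))
    (hb : z ∈ b • (L : Set H)) :
    a • (K : Set H) ∩ b • (L : Set H) = z • ((K ⊓ L : Subgroup H) : Set H) := by
  rw [leftCoset_eq_of_mem ha, leftCoset_eq_of_mem hb, Subgroup.coe_inf, Set.smul_set_inter]

theorem self_mem_smul (K : Subgroup H) (g : H) : g ∈ g • (K : Set H) := by
  simp [mem_leftCoset_iff]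

theorem smul_subset_smul_of_le {K L : Subgroup H} {g a : H} (h : K ≤ L)
    (hg : g ∈ a • (L : Set H)) : g • (K : Set H) ⊆ a • (L : Set H) := by
  rw [leftCoset_eq_of_mem hg]
  exact Set.smul_set_mono h

theorem subgroup_le_of_smul_subset_smul {K L : Subgroup H} {g a : H}
    (h : g • (K : Set H) ⊆ a • (L : Set H)) : K ≤ L := by
  rw [leftCoset_eq_of_mem (h (self_mem_smul K g))] at h
  exact Set.smul_set_subset_smul_set_iff.1 h

/-- B. H. Neumann's covering lemma, relative to a coset: in a finite cover of `z K₀` by cosets,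
those of infinite index may be dropped. -/
theorem exists_relIndex_ne_zero_of_cover {ι : Type*} (s : Finset ι) (K : ι → Subgroup H)
    (g : ι → H) (K₀ : Subgroup H) (z : H)
    (h : z • (K₀ : Set H) ⊆ ⋃ i ∈ s, g i • (K i : Set H)) {x : H} (hx : x ∈ z • (K₀ : Set H)) :
    ∃ i ∈ s, (K i).relIndex K₀ ≠ 0 ∧ x ∈ g i • (K i : Set H) := by
  classical
  have key : ∀ i, ∃ k : K₀, (∃ l : K₀, z * l ∈ g i • (K i : Set H)) →
      z * k ∈ g i • (K i : Set H) := fun i => by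
    by_cases hi : ∃ l : K₀, z * l ∈ g i • (K i : Set H)
    · exact ⟨hi.choose, fun _ => hi.choose_spec⟩
    · exact ⟨1, fun h => absurd h hi⟩
  choose k hk using key
  have mem_iff : ∀ i, (∃ l : K₀, z * l ∈ g i • (K i : Set H)) → ∀ y : K₀,
      y ∈ k i • ((K i).subgroupOf K₀ : Set K₀) ↔ z * y ∈ g i • (K i : Set H) := fun i hi y => by
    rw [leftCoset_eq_of_mem (hk i hi), mem_leftCoset_iff, mem_leftCoset_iff]
    simp [Subgroup.mem_subgroupOf, mul_assoc]
  let s' := s.filter fun i => ∃ l : K₀, z * l ∈ g i • (K i : Set H)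
  have hcover : ⋃ i ∈ s', k i • ((K i).subgroupOf K₀ : Set K₀) = Set.univ := by
    refine Set.eq_univ_of_forall fun y => ?_
    have hy : z * y ∈ z • (K₀ : Set H) := by simp [mem_leftCoset_iff]
    obtain ⟨i, hi, hyi⟩ := Set.mem_iUnion₂.1 (h hy)
    exact Set.mem_iUnion₂.2 ⟨i, Finset.mem_filter.2 ⟨hi, y, hyi⟩, (mem_iff i ⟨y, hyi⟩ y).2 hyi⟩
  have hfin := Subgroup.leftCoset_cover_filter_FiniteIndex hcover
  have hx' : z⁻¹ * x ∈ K₀ := (mem_leftCoset_iff z).1 hx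
  have hmem : (⟨z⁻¹ * x, hx'⟩ : K₀) ∈ (Set.univ : Set K₀) := trivial
  rw [← hfin] at hmem
  obtain ⟨i, hi, hxi⟩ := Set.mem_iUnion₂.1 hmem
  obtain ⟨his, hif⟩ := Finset.mem_filter.1 hi
  obtain ⟨his, hil⟩ := Finset.mem_filter.1 his
  refine ⟨i, his, hif.index_ne_zero, ?_⟩
  simpa using (mem_iff i hil _).1 hxi

/-- `C` is a coset of a subgroup which meets `K₀` in a subgroup of infinite index. -/
def IsThinCoset (K₀ : Subgroup H) (C : Set H) : Prop :=
  ∃ (g : H) (K : Subgroup H), C = g • (K : Set H) ∧ K.relIndex K₀ = 0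

theorem smul_subset_of_subset_union {K₀ : Subgroup H} {z : H} {T : Set (Set H)} (hT : T.Finite)
    (hthin : ∀ C ∈ T, IsThinCoset K₀ C) {D : Set H} (hD : IsCoset D)
    (h : z • (K₀ : Set H) ⊆ D ∪ ⋃₀ T) : z • (K₀ : Set H) ⊆ D := by
  obtain ⟨d, L, rfl⟩ := hD
  have : Fintype T := hT.fintype
  choose! g K hg hK using hthin
  intro x hx
  obtain ⟨i, -, hi, hxi⟩ := exists_relIndex_ne_zero_of_cover (Finset.univ : Finset (Option T))
    (fun i => i.elim L fun C => K C) (fun i => i.elim d fun C => g C) K₀ z (by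
      intro y hy
      rcases h hy with hy | ⟨C, hC, hy⟩
      · exact Set.mem_iUnion₂.2 ⟨none, Finset.mem_univ _, hy⟩
      · refine Set.mem_iUnion₂.2 ⟨some ⟨C, hC⟩, Finset.mem_univ _, ?_⟩
        rw [hg C hC] at hy
        exact hy) hx
  rcases i with _ | ⟨C, hC⟩
  · exact hxi
  · exact absurd (hK C hC) hi

theorem not_smul_subset_sUnion_thin {K₀ : Subgroup H} {z : H} {T : Set (Set H)} (hT : T.Finite)
    (hthin : ∀ C ∈ T, IsThinCoset K₀ C) : ¬ z • (K₀ : Set H) ⊆ ⋃₀ T := by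
  intro h
  obtain ⟨C, hC, hz⟩ := h (self_mem_smul K₀ z)
  -- Taking a singleton as the extra coset forces `K₀` to be trivial, and no subgroup has infinite
  -- index relative to `⊥`.
  have hsub : z • (K₀ : Set H) ⊆ z • ((⊥ : Subgroup H) : Set H) :=
    smul_subset_of_subset_union hT hthin ⟨z, ⊥, rfl⟩ (h.trans Set.subset_union_right)
  obtain rfl : K₀ = ⊥ := le_bot_iff.1 (subgroup_le_of_smul_subset_smul hsub)
  obtain ⟨g, K, -, hK⟩ := hthin C hC
  simp at hK

/-- Cosets of the subgroups in the family `S`. -/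
def cosetsOf (S : Set (Subgroup H)) : Set (Set H) :=
  {C | ∃ (g : H) (K : Subgroup H), K ∈ S ∧ C = g • (K : Set H)}

theorem isCoset_of_mem_cosetsOf {S : Set (Subgroup H)} {C : Set H} (h : C ∈ cosetsOf S) :
    IsCoset C :=
  let ⟨g, K, _, hC⟩ := h
  ⟨g, K, hC⟩

theorem cosetsOf_univ : cosetsOf (Set.univ : Set (Subgroup H)) = {C | IsCoset C} := by
  ext C
  simp [cosetsOf, IsCoset]

/-- `L` is the difference of a coset `E₀` and finitely many subcosets of infinite index,
all of them cosets of subgroups in `S`. -/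
def IsReducedDiff (S : Set (Subgroup H)) (E₀ L : Set H) : Prop :=
  E₀ ∈ cosetsOf S ∧ ∃ T : Set (Set H), T.Finite ∧
    (∀ C ∈ T, C ∈ cosetsOf S ∧ IsInfiniteIndexSubcoset C E₀) ∧ L = E₀ \ ⋃₀ T

theorem IsInfiniteIndexSubcoset.isThinCoset {C : Set H} {z : H} {K₀ : Subgroup H}
    (h : IsInfiniteIndexSubcoset C (z • (K₀ : Set H))) : IsThinCoset K₀ C := by
  obtain ⟨-, s, t, K, K₁, rfl, he, hK⟩ := h
  have h1 := subgroup_le_of_smul_subset_smul he.le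
  have h2 := subgroup_le_of_smul_subset_smul he.ge
  obtain rfl := le_antisymm h1 h2
  exact ⟨s, K, rfl, hK⟩

/-- What `L` omits from `E₀` is covered by thin cosets, which Neumann's lemma discards. -/
theorem IsReducedDiff.subset_of_subset {S : Set (Subgroup H)} {E₀ L D : Set H}
    (h : IsReducedDiff S E₀ L) (hD : IsCoset D) (hLD : L ⊆ D) : E₀ ⊆ D := by
  obtain ⟨⟨z, K₀, -, rfl⟩, T, hT, hC, rfl⟩ := h
  refine smul_subset_of_subset_union hT (fun C h => (hC C h).2.isThinCoset) hD fun x hx => ?_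
  by_cases hx' : x ∈ ⋃₀ T
  · exact Or.inr hx'
  · exact Or.inl (hLD ⟨hx, hx'⟩)

theorem IsReducedDiff.subset_affHull {S : Set (Subgroup H)} {E₀ L A : Set H}
    (h : IsReducedDiff S E₀ L) (hA : L ⊆ A) : E₀ ⊆ affHull A :=
  Set.subset_sInter fun _ hC => h.subset_of_subset hC.1 (hA.trans hC.2)

/-- `A` is a finite disjoint union of sets satisfying `Q`. -/
def IsFiniteDisjointUnion {X : Type*} (Q : Set X → Prop) (A : Set X) : Prop :=
  ∃ P : Set (Set X), P.Finite ∧ P.PairwiseDisjoint id ∧ ⋃₀ P = A ∧ ∀ L ∈ P, Q L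

theorem IsFiniteDisjointUnion.of_self {X : Type*} {Q : Set X → Prop} {A : Set X} (h : Q A) :
    IsFiniteDisjointUnion Q A :=
  ⟨{A}, Set.finite_singleton A, Set.pairwiseDisjoint_singleton _ _, Set.sUnion_singleton A,
    fun L hL => by rwa [Set.mem_singleton_iff.1 hL]⟩

theorem IsFiniteDisjointUnion.empty {X : Type*} {Q : Set X → Prop} :
    IsFiniteDisjointUnion Q ∅ :=
  ⟨∅, Set.finite_empty, Set.pairwiseDisjoint_empty, Set.sUnion_empty, fun _ hL => hL.elim⟩

theorem IsFiniteDisjointUnion.mono {X : Type*} {Q R : Set X → Prop} {A : Set X}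
    (h : IsFiniteDisjointUnion Q A) (hQR : ∀ L ⊆ A, Q L → R L) : IsFiniteDisjointUnion R A := by
  obtain ⟨P, hP, hd, rfl, hQ⟩ := h
  exact ⟨P, hP, hd, rfl, fun L hL => hQR L (Set.subset_sUnion_of_mem hL) (hQ L hL)⟩

theorem IsFiniteDisjointUnion.biUnion {X ι : Type*} {Q : Set X → Prop} {I : Set ι}
    (hI : I.Finite) {f : ι → Set X} (hd : I.PairwiseDisjoint f)
    (h : ∀ i ∈ I, IsFiniteDisjointUnion Q (f i)) : IsFiniteDisjointUnion Q (⋃ i ∈ I, f i) := by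
  choose! P hP hPd hPu hPQ using h
  refine ⟨⋃ i ∈ I, P i, hI.biUnion hP, ?_, ?_, ?_⟩
  · refine Set.PairwiseDisjoint.biUnion ?_ hPd
    have : ∀ i ∈ I, (⨆ L ∈ P i, id L) = f i := fun i hi => by
      rw [← hPu i hi, Set.sUnion_eq_biUnion]; rfl
    intro i hi j hj hij
    simpa only [Function.onFun, this i hi, this j hj] using! hd hi hj hij
  · simp only [Set.sUnion_iUnion]
    exact Set.iUnion₂_congr hPu
  · intro L hL
    obtain ⟨i, hi, hL⟩ := Set.mem_iUnion₂.1 hL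
    exact hPQ i hi L hL

theorem IsFiniteDisjointUnion.union {X : Type*} {Q : Set X → Prop} {A B : Set X}
    (hA : IsFiniteDisjointUnion Q A) (hB : IsFiniteDisjointUnion Q B) (hd : Disjoint A B) :
    IsFiniteDisjointUnion Q (A ∪ B) := by
  have := IsFiniteDisjointUnion.biUnion (Q := Q) (I := Set.univ) Set.finite_univ
    (f := fun b : Bool => if b then A else B) (by
      rintro (_ | _) - (_ | _) - hij
      all_goals first | exact absurd rfl hij | exact hd | exact hd.symm)
    (by rintro (_ | _) -; exacts [hB, hA])
  rw [Set.union_eq_iUnion]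
  simp only [Set.mem_univ, Set.iUnion_true] at this
  convert this using 3 with b
  cases b <;> rfl

/-- A coset of `K₀` is a finite disjoint union of cosets of a finite-index subgroup. -/
theorem finite_subcosets {K K₀ : Subgroup H} (hle : K ≤ K₀) (hK : K.relIndex K₀ ≠ 0) (z : H) :
    ∃ I : Set (Set H), I.Finite ∧ I.PairwiseDisjoint id ∧ ⋃₀ I = z • (K₀ : Set H) ∧
      ∀ D ∈ I, ∃ x ∈ z • (K₀ : Set H), D = x • (K : Set H) := by
  have : (K.subgroupOf K₀).FiniteIndex := ⟨hK⟩
  have : Finite (K₀ ⧸ K.subgroupOf K₀) := Subgroup.finite_quotient_of_finiteIndex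
  refine ⟨Set.range fun q : K₀ ⧸ K.subgroupOf K₀ => (z * (q.out : K₀)) • (K : Set H),
    Set.finite_range _, ?_, ?_, ?_⟩
  · rintro _ ⟨p, rfl⟩ _ ⟨q, rfl⟩ hne
    refine Set.disjoint_left.2 fun x hx hx' => hne ?_
    simp only [id_eq] at hx hx' ⊢
    rw [leftCoset_eq_of_mem hx, leftCoset_eq_of_mem hx']
  · ext x
    simp only [Set.mem_sUnion, Set.exists_range_iff]
    constructor
    · rintro ⟨q, hx⟩
      exact smul_subset_smul_of_le hle (by simp [mem_leftCoset_iff]) hx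
    · intro hx
      have hx' : z⁻¹ * x ∈ K₀ := (mem_leftCoset_iff z).1 hx
      refine ⟨QuotientGroup.mk ⟨z⁻¹ * x, hx'⟩, ?_⟩
      have := QuotientGroup.eq.1 (QuotientGroup.out_eq' (QuotientGroup.mk
        (s := K.subgroupOf K₀) ⟨z⁻¹ * x, hx'⟩))
      rw [mem_leftCoset_iff]
      simpa [Subgroup.mem_subgroupOf, mul_assoc] using this
  · rintro _ ⟨q, rfl⟩
    exact ⟨_, by simp [mem_leftCoset_iff], rfl⟩

/-- Induction on the number of removed cosets. If some `C` has a trace of finite index in `E₀`,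
split `E₀` into cosets of that trace's subgroup: one of them is the trace and disappears, the others
miss `C`, so `C` can be dropped. If there is no such `C`, replacing each removed coset by its
nonempty trace gives a reduced difference. -/
theorem isFiniteDisjointUnion_diff {S : Set (Subgroup H)}
    (hinf : ∀ K ∈ S, ∀ L ∈ S, K ⊓ L ∈ S) (T : Set (Set H)) (hT : T.Finite)
    (hTS : ∀ C ∈ T, C ∈ cosetsOf S) (E₀ : Set H) (hE₀ : E₀ ∈ cosetsOf S) :
    IsFiniteDisjointUnion (fun L => ∃ E, IsReducedDiff S E L) (E₀ \ ⋃₀ T) := by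
  induction hn : T.ncard generalizing T E₀ with
  | zero =>
    obtain rfl := (Set.ncard_eq_zero hT).1 hn
    exact .of_self ⟨E₀, hE₀, ∅, hT, by simp⟩
  | succ n ih =>
    obtain ⟨z, K₀, hK₀, rfl⟩ := hE₀
    by_cases hC : ∃ C ∈ T, ∃ K ∈ S, ∃ x ∈ z • (K₀ : Set H),
        C = x • (K : Set H) ∧ K.relIndex K₀ ≠ 0
    · obtain ⟨C, hCT, K, hKS, x, hx, rfl, hK⟩ := hC
      obtain ⟨I, hI, hId, hIu, hID⟩ := finite_subcosets (inf_le_right : K ⊓ K₀ ≤ K₀)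
        (by rwa [Subgroup.inf_relIndex_right]) z
      have hxx := leftCoset_inter_eq (self_mem_smul K x) hx
      have hEq : z • (K₀ : Set H) \ ⋃₀ T =
          ⋃ D ∈ I \ {x • ((K ⊓ K₀ : Subgroup H) : Set H)}, D \ ⋃₀ (T \ {x • (K : Set H)}) := by
        ext y
        simp only [Set.mem_iUnion₂, Set.mem_sdiff, Set.mem_sUnion, not_exists, not_and,
          Set.mem_singleton_iff, exists_prop]
        constructor
        · rintro ⟨hy, hyT⟩
          rw [← hIu] at hy
          obtain ⟨D, hD, hyD⟩ := hy
          refine ⟨D, ⟨hD, ?_⟩, hyD, fun C hC => hyT C hC.1⟩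
          rintro rfl
          rw [← hxx] at hyD
          exact hyT _ hCT hyD.1
        · rintro ⟨D, ⟨hD, hne⟩, hyD, hyT⟩
          have hy : y ∈ z • (K₀ : Set H) := hIu ▸ ⟨D, hD, hyD⟩
          refine ⟨hy, fun C hC hyC => ?_⟩
          by_cases hCx : C = x • (K : Set H)
          · subst hCx
            have : y ∈ x • ((K ⊓ K₀ : Subgroup H) : Set H) := hxx ▸ ⟨hyC, hy⟩
            obtain ⟨w, -, rfl⟩ := hID D hD
            exact hne (by rw [leftCoset_eq_of_mem this, leftCoset_eq_of_mem hyD])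
          · exact hyT C ⟨hC, hCx⟩ hyC
      rw [hEq]
      refine .biUnion (hI.subset Set.sdiff_subset) ?_ fun D hD => ?_
      · intro D hD D' hD' hne
        exact (hId hD.1 hD'.1 hne).mono Set.sdiff_subset Set.sdiff_subset
      · obtain ⟨w, -, rfl⟩ := hID D hD.1
        refine ih _ (hT.subset Set.sdiff_subset) (fun C hC => hTS C hC.1) _
          ⟨w, _, hinf K hKS K₀ hK₀, rfl⟩ ?_
        rw [Set.ncard_sdiff_singleton_of_mem hCT, hn]
        rfl
    · push Not at hC
      refine .of_self ⟨z • (K₀ : Set H), ⟨z, K₀, hK₀, rfl⟩,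
        {D : Set H | D.Nonempty ∧ ∃ C ∈ T, D = C ∩ z • (K₀ : Set H)}, ?_, ?_, ?_⟩
      · refine (hT.image fun C => C ∩ z • (K₀ : Set H)).subset ?_
        rintro D ⟨-, C, hC, rfl⟩
        exact ⟨C, hC, rfl⟩
      · rintro D ⟨⟨x, hx⟩, C, hCT, rfl⟩
        obtain ⟨hx, hxz⟩ := hx
        obtain ⟨g, K, hKS, rfl⟩ := hTS C hCT
        have he := leftCoset_inter_eq hx hxz
        refine ⟨⟨x, _, hinf K hKS K₀ hK₀, he⟩, Set.inter_subset_right, x, z, _, K₀, he, rfl, ?_⟩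
        rw [Subgroup.inf_relIndex_right]
        exact hC _ hCT K hKS x hxz (leftCoset_eq_of_mem hx)
      · ext y
        simp only [Set.mem_sdiff, Set.mem_sUnion, Set.mem_ofPred_eq]
        refine and_congr_right fun hy => not_congr ⟨?_, ?_⟩
        · rintro ⟨C, hC, hyC⟩
          exact ⟨C ∩ z • (K₀ : Set H), ⟨⟨y, hyC, hy⟩, C, hC, rfl⟩, hyC, hy⟩
        · rintro ⟨_, ⟨-, C, hC, rfl⟩, hyC⟩
          exact ⟨C, hC, hyC.1⟩

theorem sInter_eq_empty_or_mem_cosetsOf {S : Set (Subgroup H)} (htop : ⊤ ∈ S)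
    (hinf : ∀ K ∈ S, ∀ L ∈ S, K ⊓ L ∈ S) {T : Set (Set H)} (hT : T.Finite)
    (hTS : ∀ C ∈ T, C ∈ cosetsOf S) : ⋂₀ T = ∅ ∨ ⋂₀ T ∈ cosetsOf S := by
  induction T, hT using Set.Finite.induction_on with
  | empty => exact Or.inr ⟨1, ⊤, htop, by simp⟩
  | @insert C T _ _ ih =>
    rw [Set.sInter_insert]
    rcases ih fun C hC => hTS C (Set.mem_insert_of_mem _ hC) with h | ⟨g, K, hK, h⟩
    · exact Or.inl (by rw [h, Set.inter_empty])
    · obtain ⟨a, L, hL, rfl⟩ := hTS C (Set.mem_insert _ _)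
      rw [h]
      rcases Set.eq_empty_or_nonempty (a • (L : Set H) ∩ g • (K : Set H)) with he | ⟨x, hx, hx'⟩
      · exact Or.inl he
      · exact Or.inr ⟨x, _, hinf L hL K hK, leftCoset_inter_eq hx hx'⟩

/-- A set in the Boolean algebra generated by `𝒞` is saturated for finitely many members
of `𝒞`. -/
theorem exists_finite_saturating {X : Type*} {𝒞 : Set (Set X)} {A : Set X}
    (hA : A ∈ BooleanSubalgebra.closure 𝒞) : ∃ T : Set (Set X), T.Finite ∧ T ⊆ 𝒞 ∧
      ∀ x y, (∀ C ∈ T, x ∈ C ↔ y ∈ C) → (x ∈ A ↔ y ∈ A) := by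
  induction hA using BooleanSubalgebra.closure_bot_sup_induction with
  | mem C hC => exact ⟨{C}, Set.finite_singleton C, by simpa using hC, fun x y h => h C rfl⟩
  | bot => exact ⟨∅, Set.finite_empty, Set.empty_subset _, fun x y _ => Iff.rfl⟩
  | sup A _ B _ hA hB =>
    obtain ⟨T, hT, hTC, h⟩ := hA
    obtain ⟨T', hT', hTC', h'⟩ := hB
    refine ⟨T ∪ T', hT.union hT', Set.union_subset hTC hTC', fun x y hxy => ?_⟩
    exact or_congr (h x y fun C hC => hxy C (Or.inl hC)) (h' x y fun C hC => hxy C (Or.inr hC))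
  | compl A _ hA =>
    obtain ⟨T, hT, hTC, h⟩ := hA
    exact ⟨T, hT, hTC, fun x y hxy => not_congr (h x y hxy)⟩

/-- `A` is the union of the atoms it meets in a finite Boolean algebra; the atom of `R` is `⋂₀ R`
minus the other generators. The family `S` allows two uses: all subgroups, and closed subgroups. -/
theorem isFiniteDisjointUnion_of_mem_closure {S : Set (Subgroup H)} (htop : ⊤ ∈ S)
    (hinf : ∀ K ∈ S, ∀ L ∈ S, K ⊓ L ∈ S) {A : Set H}
    (hA : A ∈ BooleanSubalgebra.closure (cosetsOf S)) :
    IsFiniteDisjointUnion (fun L => ∃ E, IsReducedDiff S E L) A := by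
  obtain ⟨T, hT, hTS, hsat⟩ := exists_finite_saturating hA
  have mem_atom : ∀ (R : Set (Set H)) (_ : R ⊆ T) (x : H),
      x ∈ ⋂₀ R \ ⋃₀ (T \ R) ↔ R = {C ∈ T | x ∈ C} := by
    intro R hR x
    constructor
    · rintro ⟨h1, h2⟩
      refine Set.Subset.antisymm (fun C hC => ⟨hR hC, h1 C hC⟩) fun C hC => ?_
      by_contra hCR
      exact h2 ⟨C, ⟨hC.1, hCR⟩, hC.2⟩
    · rintro rfl
      refine ⟨fun C hC => hC.2, ?_⟩
      rintro ⟨C, ⟨hCT, hC⟩, hxC⟩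
      exact hC ⟨hCT, hxC⟩
  have hEq : A = ⋃ R ∈ {R | R ⊆ T ∧ ∃ x ∈ A, R = {C ∈ T | x ∈ C}}, ⋂₀ R \ ⋃₀ (T \ R) := by
    ext x
    simp only [Set.mem_iUnion₂, exists_prop]
    constructor
    · intro hx
      have hsub : {C ∈ T | x ∈ C} ⊆ T := Set.sep_subset _ _
      exact ⟨_, ⟨hsub, x, hx, rfl⟩, (mem_atom _ hsub x).2 rfl⟩
    · rintro ⟨R, ⟨hR, y, hy, hRy⟩, hx⟩
      rw [mem_atom R hR, hRy] at hx
      refine (hsat x y fun C hC => ?_).2 hy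
      have := Set.ext_iff.1 hx C
      simp only [Set.mem_ofPred_eq, hC, true_and] at this
      exact this.symm
  rw [hEq]
  refine .biUnion (hT.finite_subsets.subset fun R hR => hR.1) ?_ fun R hR => ?_
  · intro R hR R' hR' hne
    refine Set.disjoint_left.2 fun x hx hx' => hne ?_
    rw [(mem_atom R hR.1 x).1 hx, (mem_atom R' hR'.1 x).1 hx']
  · rcases sInter_eq_empty_or_mem_cosetsOf htop hinf (hT.subset hR.1)
      fun C hC => hTS (hR.1 hC) with h | h
    · rw [h, Set.empty_sdiff]
      exact .empty
    · exact isFiniteDisjointUnion_diff hinf _ (hT.subset Set.sdiff_subset)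
        (fun C hC => hTS hC.1) _ h

end Cosets

/-! ### Continuous affine extension to the closure of a coset. -/

section AffineExtension

open Filter Topology

variable {H G : Type*} [Group H] [Group G]

theorem IsAffineOn.mono {φ : H → G} {C D : Set H} (h : IsAffineOn φ D) (hCD : C ⊆ D) :
    IsAffineOn φ C :=
  fun r hr s hs t ht => h r (hCD hr) s (hCD hs) t (hCD ht)

/-- The left difference of values depends only on `a⁻¹ * b`, so continuity at a single point amounts
to left uniform continuity. -/
theorem IsAffineOn.inv_mul_eq {φ : H → G} {z : H} {K₀ : Subgroup H}
    (hφ : IsAffineOn φ (z • (K₀ : Set H))) {a b : H} (ha : a ∈ z • (K₀ : Set H))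
    (hb : b ∈ z • (K₀ : Set H)) : (φ a)⁻¹ * φ b = (φ z)⁻¹ * φ (z * (a⁻¹ * b)) := by
  have hab : z * (a⁻¹ * b) ∈ z • (K₀ : Set H) := by
    rw [mem_leftCoset_iff] at ha hb ⊢
    simpa [mul_assoc] using K₀.mul_mem (K₀.inv_mem ha) hb
  have := hφ a ha z (self_mem_smul K₀ z) _ hab
  rw [show a * z⁻¹ * (z * (a⁻¹ * b)) = b by group] at this
  rw [this]
  group

theorem IsCoset.mul_inv_mul_mem {E : Set H} (hE : IsCoset E) {r s t : H} (hr : r ∈ E)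
    (hs : s ∈ E) (ht : t ∈ E) : r * s⁻¹ * t ∈ E := by
  obtain ⟨z, K, rfl⟩ := hE
  rw [leftCoset_eq_of_mem hr]
  rw [leftCoset_eq_of_mem hs] at ht
  simpa [mem_leftCoset_iff, mul_assoc] using ht

theorem relIndex_conj_smul {K K₀ : Subgroup H} {k : H} (hk : k ∈ K₀) :
    (MulAut.conj k • K).relIndex K₀ = K.relIndex K₀ := by
  conv_lhs => rw [← Subgroup.conj_smul_eq_self_of_mem hk]
  exact Subgroup.relIndex_pointwise_smul _ _ _

variable [TopologicalSpace H] [TopologicalSpace G]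

/-- Test along an ultrafilter `u` on `K₀` converging to `1`. If convergence fails along `u`, then
for each `a` outside the removed cosets, `a * k` is eventually trapped in one of them. The `a`
trapped in a given `C` lie in a thin coset, so finitely many thin cosets would cover `z • K₀`. -/
theorem IsAffineOn.tendsto_one [IsTopologicalGroup H] [IsTopologicalGroup G] {φ : H → G} {z : H}
    {K₀ : Subgroup H} {T : Set (Set H)} (hT : T.Finite) (hthin : ∀ C ∈ T, IsThinCoset K₀ C)
    (hφ : IsAffineOn φ (z • (K₀ : Set H))) (hc : ContinuousOn φ (z • (K₀ : Set H) \ ⋃₀ T)) :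
    Tendsto (fun k => (φ z)⁻¹ * φ (z * k)) (𝓝[(K₀ : Set H)] 1) (𝓝 1) := by
  rw [tendsto_iff_ultrafilter]
  intro u hu
  have hu1 : (u : Filter H) ≤ 𝓝 1 := hu.trans nhdsWithin_le_nhds
  have huK : ∀ᶠ k in (u : Filter H), k ∈ K₀ := hu self_mem_nhdsWithin
  by_contra hnot
  have mul_mem : ∀ a ∈ z • (K₀ : Set H), ∀ k ∈ K₀, a * k ∈ z • (K₀ : Set H) := by
    intro a ha k hk
    rw [leftCoset_eq_of_mem ha]
    simpa [mem_leftCoset_iff] using hk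
  have hexc : ∀ a ∈ z • (K₀ : Set H) \ ⋃₀ T, ∃ C ∈ T, ∀ᶠ k in (u : Filter H), a * k ∈ C := by
    intro a ha
    by_cases hev : ∀ᶠ k in (u : Filter H), a * k ∈ ⋃₀ T
    · have : ⋃₀ ((fun C => (a * ·) ⁻¹' C) '' T) ∈ u := by
        refine mem_of_superset hev ?_
        rintro k ⟨C, hC, hk⟩
        exact ⟨_, ⟨C, hC, rfl⟩, hk⟩
      obtain ⟨_, ⟨C, hC, rfl⟩, hCu⟩ := (Ultrafilter.finite_sUnion_mem_iff (hT.image _)).1 this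
      exact ⟨C, hC, hCu⟩
    -- Here `a * k` stays in the domain of continuity, so continuity at `a` gives the limit at `z`
    -- by affinity.
    · refine absurd ?_ hnot
      have hev' := Ultrafilter.eventually_not.2 hev
      have hlim : Tendsto (fun k => a * k) u (𝓝[z • (K₀ : Set H) \ ⋃₀ T] a) := by
        refine tendsto_nhdsWithin_iff.2 ⟨?_, ?_⟩
        · simpa using (tendsto_const_nhds (x := a)).mul (tendsto_id.mono_left hu1)
        · filter_upwards [hev', huK] with k hk hkK
          exact ⟨mul_mem a ha.1 k hkK, hk⟩
      have hlim' := (tendsto_const_nhds (x := (φ a)⁻¹)).mul ((hc a ha).tendsto.comp hlim)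
      rw [inv_mul_cancel] at hlim'
      refine hlim'.congr' ?_
      filter_upwards [huK] with k hk
      simpa using hφ.inv_mul_eq ha.1 (mul_mem a ha.1 k hk)
  have hcov : ∀ C ∈ T, ∃ D, IsThinCoset K₀ D ∧
      ∀ a ∈ z • (K₀ : Set H) \ ⋃₀ T, (∀ᶠ k in (u : Filter H), a * k ∈ C) → a ∈ D := by
    intro C hC
    by_cases h : ∃ a₀, ∀ᶠ k in (u : Filter H), a₀ * k ∈ C
    · obtain ⟨a₀, ha₀⟩ := h
      obtain ⟨s, K, rfl, hK⟩ := hthin C hC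
      obtain ⟨k₀, hk₀, hk₀K⟩ := (ha₀.and huK).exists
      -- With `C = a₀ k₀ K`, having both `a * k` and `a₀ * k` in `C` gives `a₀⁻¹ a ∈ k₀ K k₀⁻¹`.
      -- Conjugating by `k₀ ∈ K₀` preserves the relative index.
      refine ⟨a₀ • ((MulAut.conj k₀ • K : Subgroup H) : Set H),
        ⟨a₀, _, rfl, by rwa [relIndex_conj_smul hk₀K]⟩, fun a _ ha => ?_⟩
      obtain ⟨k, hk, hk'⟩ := (ha.and ha₀).exists
      rw [leftCoset_eq_of_mem hk₀, mem_leftCoset_iff] at hk hk'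
      rw [mem_leftCoset_iff]
      simp only [SetLike.mem_coe] at hk hk' ⊢
      rw [Subgroup.mem_pointwise_smul_iff_inv_smul_mem, ← map_inv, MulAut.smul_def,
        MulAut.conj_apply]
      convert K.mul_mem hk (K.inv_mem hk') using 1
      group
    · exact ⟨C, hthin C hC, fun a _ ha => absurd ⟨a, ha⟩ h⟩
  choose! D hD hDa using hcov
  refine not_smul_subset_sUnion_thin (K₀ := K₀) (z := z) (hT.union (hT.image D)) ?_ ?_
  · rintro _ (hC | ⟨C, hC, rfl⟩)
    exacts [hthin _ hC, hD C hC]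
  · intro a ha
    by_cases haT : a ∈ ⋃₀ T
    · obtain ⟨C, hC, haC⟩ := haT
      exact ⟨C, Or.inl hC, haC⟩
    · obtain ⟨C, hC, hev⟩ := hexc a ⟨ha, haT⟩
      exact ⟨D C, Or.inr ⟨C, hC, rfl⟩, hDa C hC a ⟨ha, haT⟩ hev⟩

/-- A left uniformly continuous map into a locally compact group has limits at all points of
the closure of its domain. -/
theorem exists_tendsto_of_uniform [IsTopologicalGroup H] [IsTopologicalGroup G]
    [LocallyCompactSpace G] {φ : H → G} {E : Set H}
    (hu : ∀ W ∈ 𝓝 (1 : G), ∃ V ∈ 𝓝 (1 : H), ∀ a ∈ E, ∀ b ∈ E, a⁻¹ * b ∈ V → (φ a)⁻¹ * φ b ∈ W)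
    {h : H} (hh : h ∈ closure E) : ∃ g, Tendsto φ (𝓝[E] h) (𝓝 g) := by
  have hne : (𝓝[E] h).NeBot := mem_closure_iff_nhdsWithin_neBot.1 hh
  have hcauchy : ∀ W ∈ 𝓝 (1 : G), ∃ U ∈ 𝓝[E] h, ∀ a ∈ U, ∀ b ∈ U, (φ a)⁻¹ * φ b ∈ W := by
    intro W hW
    obtain ⟨V, hV, hVW⟩ := hu W hW
    have hcont : Tendsto (fun p : H × H => p.1⁻¹ * p.2) (𝓝 h ×ˢ 𝓝 h) (𝓝 1) := by
      have : Continuous fun p : H × H => p.1⁻¹ * p.2 := by fun_prop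
      simpa [nhds_prod_eq] using this.tendsto (h, h)
    obtain ⟨U, hU, hUV⟩ := mem_prod_same_iff.1 (hcont hV)
    refine ⟨U ∩ E, inter_mem (nhdsWithin_le_nhds hU) self_mem_nhdsWithin, ?_⟩
    intro a ha b hb
    exact hVW a ha.2 b hb.2 (hUV (Set.mk_mem_prod ha.1 hb.1))
  -- Local compactness replaces completeness: the Cauchy filter of values is eventually in a compact
  -- translate, so it clusters, and a Cauchy filter converges to its cluster point.
  obtain ⟨C, hCc, hC⟩ := exists_compact_mem_nhds (1 : G)
  obtain ⟨U, hU, hUC⟩ := hcauchy C hC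
  obtain ⟨a₀, ha₀⟩ := hne.nonempty_of_mem hU
  have hle : map φ (𝓝[E] h) ≤ 𝓟 (φ a₀ • C) := by
    rw [le_principal_iff, mem_map]
    refine mem_of_superset hU fun b hb => ?_
    exact Set.mem_smul_set_iff_inv_smul_mem.2 (hUC a₀ ha₀ b hb)
  obtain ⟨g, -, hg⟩ := (hCc.smul (φ a₀)).exists_clusterPt hle
  refine ⟨g, fun N hN => ?_⟩
  have hmul : Tendsto (fun p : G × G => p.1 * p.2) (𝓝 g ×ˢ 𝓝 1) (𝓝 g) := by
    have : Continuous fun p : G × G => p.1 * p.2 := continuous_mul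
    simpa [nhds_prod_eq] using this.tendsto (g, 1)
  obtain ⟨A, hA, W, hW, hAW⟩ := mem_prod_iff.1 (hmul hN)
  obtain ⟨U, hU, hUW⟩ := hcauchy W hW
  obtain ⟨_, hgA, a, haU, rfl⟩ := clusterPt_iff_nonempty.1 hg hA (image_mem_map hU)
  rw [mem_map]
  filter_upwards [hU] with b hb
  have := hAW (Set.mk_mem_prod hgA (hUW a haU b hb))
  simpa using this

theorem IsAffineOn.extendFrom [IsTopologicalGroup H] [IsTopologicalGroup G] [T2Space G]
    {φ : H → G} {E : Set H} (hE : IsCoset E) (hφ : IsAffineOn φ E)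
    (hlim : ∀ h ∈ closure E, ∃ g, Tendsto φ (𝓝[E] h) (𝓝 g)) :
    IsAffineOn (extendFrom E φ) (closure E) := by
  intro r hr s hs t ht
  have hr' := mem_closure_iff_nhdsWithin_neBot.1 hr
  have hs' := mem_closure_iff_nhdsWithin_neBot.1 hs
  have ht' := mem_closure_iff_nhdsWithin_neBot.1 ht
  let F := 𝓝[E] r ×ˢ 𝓝[E] s ×ˢ 𝓝[E] t
  have hmem : ∀ᶠ p : H × H × H in F, p.1 ∈ E ∧ p.2.1 ∈ E ∧ p.2.2 ∈ E :=
    (eventually_mem_nhdsWithin (a := r)).prod_mk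
      ((eventually_mem_nhdsWithin (a := s)).prod_mk (eventually_mem_nhdsWithin (a := t)))
  have h1 : Tendsto (fun p : H × H × H => p.1) F (𝓝[E] r) := tendsto_fst
  have h2 : Tendsto (fun p : H × H × H => p.2.1) F (𝓝[E] s) := tendsto_fst.comp tendsto_snd
  have h3 : Tendsto (fun p : H × H × H => p.2.2) F (𝓝[E] t) := tendsto_snd.comp tendsto_snd
  have hin : Tendsto (fun p : H × H × H => p.1 * p.2.1⁻¹ * p.2.2) F (𝓝[E] (r * s⁻¹ * t)) := by
    refine tendsto_nhdsWithin_iff.2 ⟨?_, hmem.mono fun p hp =>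
      hE.mul_inv_mul_mem hp.1 hp.2.1 hp.2.2⟩
    exact ((h1.mono_right nhdsWithin_le_nhds).mul
      (h2.mono_right nhdsWithin_le_nhds).inv).mul (h3.mono_right nhdsWithin_le_nhds)
  have hcl : r * s⁻¹ * t ∈ closure E := mem_closure_iff_nhdsWithin_neBot.2 hin.neBot
  have e1 := (tendsto_extendFrom (hlim r hr)).comp h1
  have e2 := (tendsto_extendFrom (hlim s hs)).comp h2
  have e3 := (tendsto_extendFrom (hlim t ht)).comp h3
  have e := (tendsto_extendFrom (hlim _ hcl)).comp hin
  refine tendsto_nhds_unique e (((e1.mul e2.inv).mul e3).congr' ?_)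
  exact hmem.mono fun p hp => (hφ _ hp.1 _ hp.2.1 _ hp.2.2).symm

theorem IsReducedDiff.exists_continuous_affine_extension [IsTopologicalGroup H]
    [IsTopologicalGroup G] [LocallyCompactSpace G] [T2Space G] {S : Set (Subgroup H)}
    {E L : Set H} (hL : IsReducedDiff S E L) {φ : H → G} (hφ : IsAffineOn φ E)
    (hc : ContinuousOn φ L) :
    ∃ ψ : H → G, ContinuousOn ψ (closure E) ∧ IsAffineOn ψ (closure E) ∧ Set.EqOn ψ φ E := by
  obtain ⟨⟨z, K₀, -, rfl⟩, T, hT, hTS, rfl⟩ := hL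
  have hone := hφ.tendsto_one hT (fun C hC => (hTS C hC).2.isThinCoset) hc
  have hlim : ∀ h ∈ closure (z • (K₀ : Set H)),
      ∃ g, Tendsto φ (𝓝[z • (K₀ : Set H)] h) (𝓝 g) := by
    intro h hh
    refine exists_tendsto_of_uniform (fun W hW => ?_) hh
    obtain ⟨V, hV, hVW⟩ := mem_nhdsWithin_iff_exists_mem_nhds_inter.1 (hone hW)
    refine ⟨V, hV, fun a ha b hb hab => ?_⟩
    rw [hφ.inv_mul_eq ha hb]
    refine hVW ⟨hab, ?_⟩
    rw [leftCoset_eq_of_mem ha] at hb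
    exact (mem_leftCoset_iff a).1 hb
  refine ⟨extendFrom (z • (K₀ : Set H)) φ, continuousOn_extendFrom subset_rfl hlim,
    hφ.extendFrom ⟨z, K₀, rfl⟩ hlim, fun x hx => ?_⟩
  obtain ⟨g, hg⟩ := hlim x (subset_closure hx)
  rw [extendFrom_eq (subset_closure hx) hg]
  exact tendsto_nhds_unique (hg.mono_left (pure_le_nhdsWithin hx))
    (tendsto_pure_nhds φ x)

end AffineExtension

/-! ### Sandwiching between a set and its closure by closed cosets. -/

section ClosureOfCosetRing

open Filter Topology

variable {H : Type*} [Group H] [TopologicalSpace H]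

/-- Some neighbourhood of `1` in `K₀` is covered by finitely many left cosets of `K`. -/
def HasFiniteLocalIndex (K K₀ : Subgroup H) : Prop :=
  ∃ V ∈ 𝓝 (1 : H), ∃ F : Set H, F.Finite ∧ V ∩ K₀ ⊆ ⋃ f ∈ F, f • (K : Set H)

variable [IsTopologicalGroup H]

/-- A local version of Neumann's lemma: if finitely many cosets cover a nonempty relatively open
subset of `K₀`, then one of the subgroups has finite local index. -/
theorem exists_hasFiniteLocalIndex_of_cover {K₀ : Subgroup H} {𝒦 : Set (Subgroup H)}
    (h𝒦 : 𝒦.Finite) (hle : ∀ K ∈ 𝒦, K ≤ K₀) {U : Set H} (hU : IsOpen U) {F : Set H}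
    (hF : F.Finite) {p : H} (hpU : p ∈ U) (hpK : p ∈ K₀)
    (hcov : U ∩ K₀ ⊆ ⋃ K ∈ 𝒦, ⋃ f ∈ F, f • (K : Set H)) :
    ∃ K ∈ 𝒦, HasFiniteLocalIndex K K₀ := by
  induction 𝒦, h𝒦 using Set.Finite.induction_on generalizing U F p with
  | empty => simpa using hcov ⟨hpU, hpK⟩
  | @insert K 𝒦 _ _ ih =>
    by_cases hK : HasFiniteLocalIndex K K₀
    · exact ⟨K, Set.mem_insert _ _, hK⟩
    -- Since `K` lacks finite local index, its listed cosets miss some `q`, hence all of `q • K`.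
    -- Near `q`, each coset of `K` is translated into `q • K`, where only the other subgroups can
    -- cover; translating back eliminates `K` from the cover.
    obtain ⟨q, hqU, hqK, hq⟩ : ∃ q ∈ U, q ∈ K₀ ∧ ∀ f ∈ F, q ∉ f • (K : Set H) := by
      by_contra! hall
      refine hK ⟨(p * ·) ⁻¹' U, ?_, (p⁻¹ * ·) '' F, hF.image _, ?_⟩
      · refine (hU.preimage (continuous_const_mul p)).mem_nhds ?_
        simpa using hpU
      · rintro x ⟨hxU, hxK⟩
        obtain ⟨f, hf, hx⟩ := hall (p * x) hxU (K₀.mul_mem hpK hxK)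
        refine Set.mem_iUnion₂.2 ⟨p⁻¹ * f, ⟨f, hf, rfl⟩, ?_⟩
        rw [mem_leftCoset_iff] at hx ⊢
        simpa [mul_assoc] using hx
    have hcont : Tendsto (fun x : H × H => q * x.1⁻¹ * x.2) (𝓝 q ×ˢ 𝓝 q) (𝓝 q) := by
      have : Continuous fun x : H × H => q * x.1⁻¹ * x.2 := by fun_prop
      simpa [nhds_prod_eq] using this.tendsto (q, q)
    obtain ⟨N', hN', hNU'⟩ := mem_prod_same_iff.1 (hcont (hU.mem_nhds hqU))
    obtain ⟨N, hNN', hN, hqN⟩ := mem_nhds_iff.1 hN'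
    have hchoose : ∀ f : H, ∃ g : H, (∃ g, g ∈ f • (K : Set H) ∧ g ∈ N) →
        g ∈ f • (K : Set H) ∧ g ∈ N := fun f => by
      by_cases h : ∃ g, g ∈ f • (K : Set H) ∧ g ∈ N
      · exact ⟨h.choose, fun _ => h.choose_spec⟩
      · exact ⟨1, fun h' => absurd h' h⟩
    choose g hg using hchoose
    obtain ⟨K', hK', h⟩ := ih (fun K hK => hle K (Set.mem_insert_of_mem _ hK)) (hU.inter hN)
      (F := F ∪ Set.image2 (fun f f' => g f * q⁻¹ * f') F F)
      (hF.union (hF.image2 _ hF)) ⟨hqU, hqN⟩ hqK (by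
        rintro x ⟨⟨hxU, hxN⟩, hxK⟩
        obtain ⟨K', hK', hx⟩ := Set.mem_iUnion₂.1 (hcov ⟨hxU, hxK⟩)
        obtain ⟨f, hf, hx⟩ := Set.mem_iUnion₂.1 hx
        rcases hK' with rfl | hK'
        · obtain ⟨hgK, hgN⟩ := hg f ⟨x, hx, hxN⟩
          have hgx : (g f)⁻¹ * x ∈ K' := by
            rw [leftCoset_eq_of_mem hgK] at hx
            exact (mem_leftCoset_iff _).1 hx
          have hyU : q * (g f)⁻¹ * x ∈ U := hNU' (Set.mk_mem_prod (hNN' hgN) (hNN' hxN))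
          have hyK : q * (g f)⁻¹ * x ∈ K₀ := by
            rw [mul_assoc]
            exact K₀.mul_mem hqK (hle K' (Set.mem_insert _ _) hgx)
          obtain ⟨K'', hK'', hy⟩ := Set.mem_iUnion₂.1 (hcov ⟨hyU, hyK⟩)
          obtain ⟨f', hf', hy⟩ := Set.mem_iUnion₂.1 hy
          rcases hK'' with rfl | hK''
          · refine absurd ?_ (hq f' hf')
            rw [mem_leftCoset_iff] at hy ⊢
            have := K''.mul_mem hy (K''.inv_mem hgx)
            simpa [mul_assoc] using this
          · refine Set.mem_iUnion₂.2 ⟨K'', hK'', Set.mem_iUnion₂.2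
              ⟨g f * q⁻¹ * f', Or.inr ⟨f, hf, f', hf', rfl⟩, ?_⟩⟩
            rw [mem_leftCoset_iff] at hy ⊢
            simpa [mul_assoc] using hy
        · exact Set.mem_iUnion₂.2 ⟨K', hK', Set.mem_iUnion₂.2 ⟨f, Or.inl hf, hx⟩⟩)
    exact ⟨K', Set.mem_insert_of_mem _ hK', h⟩

/-- Otherwise the traces would cover a nonempty relatively open part of the coset, and the local
Neumann lemma would give one of them finite local index. -/
theorem closure_smul_subset_closure_diff {z : H} {K₀ : Subgroup H} {T : Set (Set H)}
    (hT : T.Finite) (h : ∀ C ∈ T, (C ∩ z • (K₀ : Set H)).Nonempty → ∃ (g : H) (K : Subgroup H),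
      K ≤ K₀ ∧ C ∩ z • (K₀ : Set H) = g • (K : Set H) ∧ ¬ HasFiniteLocalIndex K K₀) :
    closure (z • (K₀ : Set H)) ⊆ closure (z • (K₀ : Set H) \ ⋃₀ T) := by
  intro x hx
  rw [mem_closure_iff] at hx ⊢
  intro O hO hxO
  obtain ⟨y, hyO, hy⟩ := hx O hO hxO
  by_contra hempty
  have hsub : ∀ w ∈ O, w ∈ z • (K₀ : Set H) → w ∈ ⋃₀ T := by
    intro w hwO hw
    by_contra hwT
    exact hempty ⟨w, hwO, hw, hwT⟩
  choose! g K hKle hCK hK using h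
  obtain ⟨_, ⟨C, ⟨hC, hCn⟩, rfl⟩, hfin⟩ := exists_hasFiniteLocalIndex_of_cover
    (𝒦 := K '' {C ∈ T | (C ∩ z • (K₀ : Set H)).Nonempty}) (K₀ := K₀)
    ((hT.subset (Set.sep_subset _ _)).image _) (by rintro _ ⟨C, ⟨hC, hCn⟩, rfl⟩; exact hKle C hC hCn)
    (hO.preimage (continuous_const_mul z)) (hT.image fun C => z⁻¹ * g C) (p := z⁻¹ * y)
    (by simpa using hyO) ((mem_leftCoset_iff z).1 hy) (by
      rintro w ⟨hwO, hwK⟩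
      have hzw : z * w ∈ z • (K₀ : Set H) := by simpa [mem_leftCoset_iff] using hwK
      obtain ⟨C, hC, hwC⟩ := hsub (z * w) hwO hzw
      have hCn : (C ∩ z • (K₀ : Set H)).Nonempty := ⟨_, hwC, hzw⟩
      refine Set.mem_iUnion₂.2 ⟨K C, ⟨C, ⟨hC, hCn⟩, rfl⟩, Set.mem_iUnion₂.2
        ⟨z⁻¹ * g C, ⟨C, hC, rfl⟩, ?_⟩⟩
      have : z * w ∈ g C • (K C : Set H) := by
        rw [← hCK C hC hCn]
        exact ⟨hwC, hzw⟩
      rw [mem_leftCoset_iff] at this ⊢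
      simpa [mul_assoc] using this)
  exact hK C hC hCn hfin

/-- A point of the closure differs from a nearby point of `x • K` by an element of `V ∩ K₀`, which
finitely many cosets of `K` cover. -/
theorem HasFiniteLocalIndex.closure_inter_subset {K K₀ : Subgroup H}
    (h : HasFiniteLocalIndex K K₀) (hle : K ≤ K₀) (x : H) :
    ∃ F : Set H, F.Finite ∧
      closure (x • (K : Set H)) ∩ x • (K₀ : Set H) ⊆ ⋃ f ∈ F, (x * f) • (K : Set H) := by
  obtain ⟨V, hV, F, hF, hVF⟩ := h
  refine ⟨F, hF, ?_⟩
  rintro y ⟨hy, hyK⟩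
  have hyK : x⁻¹ * y ∈ K₀ := (mem_leftCoset_iff x).1 hyK
  have hcont : Tendsto (fun w : H => (x⁻¹ * y) * (x⁻¹ * w)⁻¹) (𝓝 y) (𝓝 1) := by
    have : Continuous fun w : H => (x⁻¹ * y) * (x⁻¹ * w)⁻¹ := by fun_prop
    simpa using this.tendsto y
  obtain ⟨w, hwV, hw⟩ := mem_closure_iff_nhds.1 hy _ (hcont hV)
  have hw : x⁻¹ * w ∈ K := (mem_leftCoset_iff x).1 hw
  obtain ⟨f, hf, hyf⟩ := Set.mem_iUnion₂.1
    (hVF ⟨hwV, K₀.mul_mem hyK (K₀.inv_mem (hle hw))⟩)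
  refine Set.mem_iUnion₂.2 ⟨f, hf, ?_⟩
  rw [mem_leftCoset_iff] at hyf ⊢
  have := K.mul_mem hyf hw
  simpa [mul_assoc] using this

/-- The Boolean algebra generated by the closed cosets. -/
def closedCosetRing (H : Type*) [Group H] [TopologicalSpace H] : BooleanSubalgebra (Set H) :=
  BooleanSubalgebra.closure (cosetsOf {K : Subgroup H | IsClosed (K : Set H)})

theorem closure_smul_mem_cosetsOf (z : H) (K : Subgroup H) :
    closure (z • (K : Set H)) ∈ cosetsOf {K : Subgroup H | IsClosed (K : Set H)} :=
  ⟨z, K.topologicalClosure, K.isClosed_topologicalClosure, by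
    rw [Subgroup.topologicalClosure_coe, closure_smul]⟩

theorem closure_smul_mem_closedCosetRing (z : H) (K : Subgroup H) :
    closure (z • (K : Set H)) ∈ closedCosetRing H :=
  BooleanSubalgebra.subset_closure (closure_smul_mem_cosetsOf z K)

/-- Induction on the number of removed cosets. `B` records the closed cosets already cut out;
`hopen` keeps it relatively open in `closure E`, so that density survives intersecting with `B`. -/
theorem exists_closedCosetRing_between {T : Set (Set H)} (hT : T.Finite)
    (hTC : ∀ C ∈ T, IsCoset C) {E B : Set H} (hE : IsCoset E) (hB : B ∈ closedCosetRing H)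
    (hopen : ∀ x ∈ closure E ∩ B, B ∈ 𝓝[closure E] x) :
    ∃ B' ∈ closedCosetRing H, (E ∩ B) \ ⋃₀ T ⊆ B' ∧ B' ⊆ closure ((E ∩ B) \ ⋃₀ T) := by
  induction hn : T.ncard using Nat.strong_induction_on generalizing T E B with
  | _ n ih =>
  obtain ⟨z, K₀, rfl⟩ := hE
  by_cases hfin : ∃ C ∈ T, ∃ x ∈ z • (K₀ : Set H), ∃ K ≤ K₀,
      C ∩ z • (K₀ : Set H) = x • (K : Set H) ∧ HasFiniteLocalIndex K K₀
  · obtain ⟨C, hC, x, hx, K, hle, hCK, hK⟩ := hfin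
    obtain ⟨F, hF, hFcov⟩ := hK.closure_inter_subset hle x
    rw [leftCoset_eq_of_mem hx] at hopen hCK ⊢
    have hcard : (T \ {C}).ncard < n := hn ▸ Set.ncard_sdiff_singleton_lt_of_mem hC hT
    have hT' : (T \ {C}).Finite := hT.subset Set.sdiff_subset
    have hTC' : ∀ C' ∈ T \ {C}, IsCoset C' := fun C' h => hTC C' h.1
    -- Away from `closure (x • K)` the coset `C` removes nothing more. Inside it, `E` is covered by
    -- finitely many cosets of `K`; those other than `x • K` miss `C`. Both parts need one removed
    -- coset fewer.
    obtain ⟨B₁, hB₁, hsub₁, hcl₁⟩ := ih _ hcard hT' hTC' (B := B \ closure (x • (K : Set H)))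
      ⟨x, K₀, rfl⟩ (BooleanSubalgebra.sdiff_mem hB (closure_smul_mem_closedCosetRing x K))
      (fun y hy => inter_mem (hopen y ⟨hy.1, hy.2.1⟩)
        (nhdsWithin_le_nhds (isClosed_closure.isOpen_compl.mem_nhds hy.2.2))) rfl
    have hpiece : ∀ f ∈ {f ∈ F | f ∈ K₀}, ∃ B' ∈ closedCosetRing H,
        ((x * f) • (K : Set H) ∩ B) \ ⋃₀ (T \ {C}) ⊆ B' ∧
          B' ⊆ closure (((x * f) • (K : Set H) ∩ B) \ ⋃₀ (T \ {C})) := by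
      rintro f ⟨-, hf⟩
      refine ih _ hcard hT' hTC' ⟨_, K, rfl⟩ hB (fun y hy => ?_) rfl
      have hmono : closure ((x * f) • (K : Set H)) ⊆ closure (x • (K₀ : Set H)) :=
        closure_mono (smul_subset_smul_of_le hle (by simpa [mem_leftCoset_iff] using hf))
      exact nhdsWithin_mono _ hmono (hopen y ⟨hmono hy.1, hy.2⟩)
    choose! B' hB' hsub hcl using hpiece
    let F' := {f ∈ F | f ∈ K₀ ∧ f ∉ K}
    have hF' : F'.Finite := hF.subset (Set.sep_subset _ _)
    refine ⟨B₁ ∪ ⋃ f ∈ F', B' f, BooleanSubalgebra.sup_mem hB₁ ?_, ?_, ?_⟩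
    · exact BooleanSubalgebra.biSup_mem hF' fun f hf => hB' f ⟨hf.1, hf.2.1⟩
    · rintro y ⟨⟨hy, hyB⟩, hyT⟩
      have hyT' : y ∉ ⋃₀ (T \ {C}) := fun ⟨C', hC', hyC'⟩ => hyT ⟨C', hC'.1, hyC'⟩
      have hyC : y ∉ x • (K : Set H) := fun h => hyT ⟨C, hC, (hCK ▸ h).1⟩
      by_cases hycl : y ∈ closure (x • (K : Set H))
      · obtain ⟨f, hf, hyf⟩ := Set.mem_iUnion₂.1 (hFcov ⟨hycl, hy⟩)
        have hfK₀ : f ∈ K₀ := by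
          rw [mem_leftCoset_iff] at hy hyf
          have := K₀.mul_mem hy (K₀.inv_mem (hle hyf))
          simpa [mul_assoc] using this
        have hfK : f ∉ K := fun h => hyC
          (smul_subset_smul_of_le le_rfl (by simpa [mem_leftCoset_iff] using h) hyf)
        exact Or.inr (Set.mem_iUnion₂.2
          ⟨f, ⟨hf, hfK₀, hfK⟩, hsub f ⟨hf, hfK₀⟩ ⟨⟨hyf, hyB⟩, hyT'⟩⟩)
      · exact Or.inl (hsub₁ ⟨⟨hy, hyB, hycl⟩, hyT'⟩)
    · refine Set.union_subset (hcl₁.trans (closure_mono ?_)) (Set.iUnion₂_subset fun f hf =>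
        (hcl f ⟨hf.1, hf.2.1⟩).trans (closure_mono ?_))
      · rintro y ⟨⟨hy, hyB, hycl⟩, hyT⟩
        refine ⟨⟨hy, hyB⟩, fun ⟨C', hC', hyC'⟩ => ?_⟩
        by_cases hCC : C' = C
        · exact hycl (subset_closure (hCK ▸ ⟨hCC ▸ hyC', hy⟩))
        · exact hyT ⟨C', ⟨hC', hCC⟩, hyC'⟩
      · rintro y ⟨⟨hy, hyB⟩, hyT⟩
        have hyK₀ : y ∈ x • (K₀ : Set H) :=
          smul_subset_smul_of_le hle (by simpa [mem_leftCoset_iff] using hf.2.1) hy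
        refine ⟨⟨hyK₀, hyB⟩, fun ⟨C', hC', hyC'⟩ => ?_⟩
        by_cases hCC : C' = C
        · have hyK : y ∈ x • (K : Set H) := hCK ▸ ⟨hCC ▸ hyC', hyK₀⟩
          refine hf.2.2 ?_
          rw [mem_leftCoset_iff] at hy hyK
          have := K.mul_mem hyK (K.inv_mem hy)
          simpa [mul_assoc] using this
        · exact hyT ⟨C', ⟨hC', hCC⟩, hyC'⟩
  -- With no trace of finite local index, the removed cosets are invisible to the closure, and
  -- `closure E ∩ B` serves as the witness.
  · have hdense : closure (z • (K₀ : Set H)) ⊆ closure (z • (K₀ : Set H) \ ⋃₀ T) := by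
      refine closure_smul_subset_closure_diff hT fun C hC ⟨x, hxC, hx⟩ => ?_
      obtain ⟨g, K, rfl⟩ := hTC C hC
      have hEq := leftCoset_inter_eq hxC hx
      exact ⟨x, K ⊓ K₀, inf_le_right, hEq,
        fun h => hfin ⟨_, hC, x, hx, K ⊓ K₀, inf_le_right, hEq, h⟩⟩
    refine ⟨closure (z • (K₀ : Set H)) ∩ B,
      BooleanSubalgebra.inf_mem (closure_smul_mem_closedCosetRing z K₀) hB,
      fun y hy => ⟨subset_closure hy.1.1, hy.1.2⟩, fun x hx => ?_⟩
    have hev := eventually_nhdsWithin_iff.1 (hopen x hx)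
    refine mem_closure_iff_frequently.2
      (((mem_closure_iff_frequently.1 (hdense hx.1)).and_eventually hev).mono ?_)
    rintro y ⟨⟨hy, hyT⟩, hyB⟩
    exact ⟨⟨hy, hyB (subset_closure hy)⟩, hyT⟩

end ClosureOfCosetRing

/-! ### Affine pieces of a map into the one-point compactification. -/

section PiecewiseAffine

open Filter Topology

variable {G H : Type*} [Group G] [TopologicalSpace G] [Group H] [TopologicalSpace H]

/-- On `B` the map `f` agrees with a continuous affine map defined on some coset containing `B`. -/
def ExtendsAffinely (f : H → OnePoint G) (B : Set H) : Prop :=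
  ∃ (D : Set H) (ψ : H → G), IsCoset D ∧ B ⊆ D ∧ ContinuousOn ψ D ∧ IsAffineOn ψ D ∧
    ∀ h ∈ B, f h = ψ h

theorem ExtendsAffinely.mono {f : H → OnePoint G} {B C : Set H} (h : ExtendsAffinely f C)
    (hBC : B ⊆ C) : ExtendsAffinely f B := by
  obtain ⟨D, ψ, hD, hCD, hc, ha, hf⟩ := h
  exact ⟨D, ψ, hD, hBC.trans hCD, hc, ha, fun x hx => hf x (hBC hx)⟩

/-- Subtracting the earlier sets makes the union disjoint within the ring, and affine extendability
passes to subsets. -/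
theorem isFiniteDisjointUnion_sUnion {f : H → OnePoint G} {𝓑 : Set (Set H)} (h𝓑 : 𝓑.Finite)
    (hring : ∀ B ∈ 𝓑, B ∈ closedCosetRing H) (hf : ∀ B ∈ 𝓑, ExtendsAffinely f B) :
    IsFiniteDisjointUnion (fun L =>
      (∃ E, IsReducedDiff {K : Subgroup H | IsClosed (K : Set H)} E L) ∧ ExtendsAffinely f L)
      (⋃₀ 𝓑) := by
  induction 𝓑, h𝓑 using Set.Finite.induction_on with
  | empty =>
    rw [Set.sUnion_empty]
    exact .empty
  | @insert B 𝓑 _ hfin ih =>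
    have hring' := fun C hC => hring C (Set.mem_insert_of_mem B hC)
    rw [Set.sUnion_insert, Set.union_comm, ← Set.union_sdiff_self]
    refine (ih hring' fun C hC => hf C (Set.mem_insert_of_mem B hC)).union ?_
      Set.disjoint_sdiff_right
    have hU : ⋃₀ 𝓑 ∈ closedCosetRing H := by
      rw [Set.sUnion_eq_biUnion]
      exact BooleanSubalgebra.biSup_mem hfin hring'
    refine (isFiniteDisjointUnion_of_mem_closure (S := {K : Subgroup H | IsClosed (K : Set H)})
      isClosed_univ (fun K hK L hL => IsClosed.inter hK hL)
      (BooleanSubalgebra.sdiff_mem (hring B (Set.mem_insert _ _)) hU)).mono fun L hL h => ?_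
    exact ⟨h, (hf B (Set.mem_insert _ _)).mono (hL.trans Set.sdiff_subset)⟩

variable [IsTopologicalGroup H]

/-- `OnePoint G` is Hausdorff, so equality of `f` with the extended affine map passes from `L` to
its closure. In particular `f` avoids `∞` there. -/
theorem IsReducedDiff.extendsAffinely_closure [IsTopologicalGroup G] [LocallyCompactSpace G]
    [T2Space G] {S : Set (Subgroup H)} {E L : Set H} (hL : IsReducedDiff S E L)
    {f : H → OnePoint G} (hf : Continuous f) {φ : H → G} (hφ : IsAffineOn φ E)
    (hfφ : ∀ h ∈ L, f h = φ h) : ExtendsAffinely f (closure L) := by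
  have hLE : L ⊆ E := by
    obtain ⟨-, T, -, -, rfl⟩ := hL
    exact Set.sdiff_subset
  have hc : ContinuousOn φ L := by
    rw [OnePoint.isOpenEmbedding_coe.isInducing.continuousOn_iff]
    exact hf.continuousOn.congr fun h hh => (hfφ h hh).symm
  obtain ⟨ψ, hψc, hψa, hψ⟩ := hL.exists_continuous_affine_extension hφ hc
  have hsub : closure L ⊆ closure E := closure_mono hLE
  have hcoset : IsCoset (closure E) := by
    obtain ⟨⟨z, K, -, rfl⟩, -⟩ := hL
    exact isCoset_of_mem_cosetsOf (closure_smul_mem_cosetsOf z K)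
  refine ⟨closure E, ψ, hcoset, hsub, hψc, hψa, ?_⟩
  have heq : Set.EqOn f (fun h => (ψ h : OnePoint G)) L := fun h hh => by
    simp only [hfφ h hh, hψ (hLE hh)]
  exact heq.of_subset_closure hf.continuousOn
    (OnePoint.continuous_coe.comp_continuousOn (hψc.mono hsub)) subset_closure subset_rfl

end PiecewiseAffine

theorem proposition4p5
    {G H : Type*}
    [Group G] [TopologicalSpace G] [IsTopologicalGroup G] [LocallyCompactSpace G] [T2Space G]
    [Group H] [TopologicalSpace H] [IsTopologicalGroup H] [LocallyCompactSpace H] [T2Space H]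
    [MeasurableSpace H] [BorelSpace H]
    (αInf : H → OnePoint G) (hcont : Continuous αInf)
    (Y : Set H) (hY : Y = αInf ⁻¹' Set.range ((↑) : G → OnePoint G))
    (α : Y → G) (hα : ∀ y : Y, αInf y = (α y : OnePoint G))
    (hpa : IsPiecewiseAffine α) :
    IsClopen Y ∧
    ∃ (n : ℕ) (m : Fin n → ℕ) (E₀ : Fin n → Set H) (E : (i : Fin n) → Fin (m i) → Set H)
      (φ : Fin n → H → G),
      (∀ i, IsCoset (E₀ i) ∧ MeasurableSet (E₀ i)) ∧
      (∀ i j, IsInfiniteIndexSubcoset (E i j) (E₀ i) ∧ MeasurableSet (E i j)) ∧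
      Pairwise (Function.onFun Disjoint fun i => E₀ i \ ⋃ j, E i j) ∧
      Y = ⋃ i, (E₀ i \ ⋃ j, E i j) ∧
      ∀ i, ContinuousOn (φ i) (closure (E₀ i)) ∧ IsAffineOn (φ i) (closure (E₀ i)) ∧
        ∀ y : Y, (y : H) ∈ E₀ i \ ⋃ j, E i j → φ i y = α y := by
  obtain ⟨k, P, φ, hP, -, hYP, hφ⟩ := hpa
  have hYmem : ∀ h, h ∈ Y ↔ ∃ g : G, αInf h = g := by
    intro h
    rw [hY]
    exact ⟨fun ⟨g, hg⟩ => ⟨g, hg.symm⟩, fun ⟨g, hg⟩ => ⟨g, hg.symm⟩⟩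
  have hext : ∀ i, ∃ 𝓛 : Set (Set H), 𝓛.Finite ∧ ⋃₀ 𝓛 = P i ∧ ∀ L ∈ 𝓛,
      ExtendsAffinely αInf (closure L) ∧ ∃ B ∈ closedCosetRing H, L ⊆ B ∧ B ⊆ closure L := by
    intro i
    have hPi := hP i
    rw [cosetRing, ← cosetsOf_univ] at hPi
    obtain ⟨𝓛, hfin, -, hU, hred⟩ := isFiniteDisjointUnion_of_mem_closure (Set.mem_univ _)
      (fun _ _ _ _ => Set.mem_univ _) hPi
    refine ⟨𝓛, hfin, hU, fun L hL => ?_⟩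
    obtain ⟨E, hE⟩ := hred L hL
    have hLP : L ⊆ P i := hU ▸ Set.subset_sUnion_of_mem hL
    refine ⟨hE.extendsAffinely_closure hcont ((hφ i).1.mono (hE.subset_affHull hLP))
      fun h hh => ?_, ?_⟩
    · have hhY : h ∈ Y := hYP ▸ Set.mem_iUnion.2 ⟨i, hLP hh⟩
      rw [hα ⟨h, hhY⟩, (hφ i).2 ⟨h, hhY⟩ (hLP hh)]
    · obtain ⟨hE₀, T, hT, hTE, rfl⟩ := hE
      -- Nothing has been cut out yet, so the induction starts from `B = univ`.
      simpa using exists_closedCosetRing_between hT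
        (fun C hC => isCoset_of_mem_cosetsOf (hTE C hC).1)
        (isCoset_of_mem_cosetsOf hE₀) (B := Set.univ) BooleanSubalgebra.top_mem
        fun _ _ => Filter.univ_mem
  choose 𝓛 h𝓛 h𝓛P hext B hB hLB hBL using hext
  have hclY : ∀ i, ∀ L ∈ 𝓛 i, closure L ⊆ Y := by
    intro i L hL h hh
    obtain ⟨D, ψ, -, -, -, -, hψ⟩ := hext i L hL
    exact (hYmem h).2 ⟨ψ h, hψ h hh⟩
  have hclosed : IsClosed Y := by
    have : Y = ⋃ i, ⋃ L ∈ 𝓛 i, closure L := by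
      refine Set.Subset.antisymm ?_ (Set.iUnion_subset fun i => Set.iUnion₂_subset (hclY i))
      intro h hh
      rw [hYP] at hh
      obtain ⟨i, hi⟩ := Set.mem_iUnion.1 hh
      rw [← h𝓛P i] at hi
      obtain ⟨L, hL, hhL⟩ := hi
      exact Set.mem_iUnion.2 ⟨i, Set.mem_iUnion₂.2 ⟨L, hL, subset_closure hhL⟩⟩
    rw [this]
    exact isClosed_iUnion_of_finite fun i => (h𝓛 i).isClosed_biUnion fun L _ => isClosed_closure
  refine ⟨⟨hclosed, hY ▸ OnePoint.isOpen_range_coe.preimage hcont⟩, ?_⟩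
  let 𝓑 : Set (Set H) := {C | ∃ i L, ∃ hL : L ∈ 𝓛 i, C = B i L hL}
  have h𝓑 : 𝓑.Finite := by
    have : 𝓑 = ⋃ i, Set.range fun L : 𝓛 i => B i L L.2 := by
      ext C
      simp [𝓑, eq_comm]
    rw [this]
    have := fun i => (h𝓛 i).to_subtype
    exact Set.finite_iUnion fun i => Set.finite_range _
  have h𝓑U : ⋃₀ 𝓑 = Y := by
    refine Set.Subset.antisymm ?_ ?_
    · rintro h ⟨_, ⟨i, L, hL, rfl⟩, hh⟩
      exact hclY i L hL (hBL i L hL hh)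
    · intro h hh
      rw [hYP] at hh
      obtain ⟨i, hi⟩ := Set.mem_iUnion.1 hh
      rw [← h𝓛P i] at hi
      obtain ⟨L, hL, hhL⟩ := hi
      exact ⟨_, ⟨i, L, hL, rfl⟩, hLB i L hL hhL⟩
  obtain ⟨Q, hQ, hQd, hQU, hQred⟩ := isFiniteDisjointUnion_sUnion (f := αInf) h𝓑
    (by rintro _ ⟨i, L, hL, rfl⟩; exact hB i L hL)
    (by rintro _ ⟨i, L, hL, rfl⟩; exact (hext i L hL).mono (hBL i L hL))
  rw [h𝓑U] at hQU
  have hpieces : ∀ L : Q, ∃ (E₀ : Set H) (m : ℕ) (E : Fin m → Set H) (ψ : H → G),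
      (IsCoset E₀ ∧ MeasurableSet E₀) ∧
      (∀ j, IsInfiniteIndexSubcoset (E j) E₀ ∧ MeasurableSet (E j)) ∧
      (L : Set H) = E₀ \ ⋃ j, E j ∧
      ContinuousOn ψ (closure E₀) ∧ IsAffineOn ψ (closure E₀) ∧ ∀ h ∈ (L : Set H), αInf h = ψ h := by
    rintro ⟨L, hL⟩
    obtain ⟨⟨E₀, hred⟩, D, ψ, hD, hLD, hψc, hψa, hψ⟩ := hQred L hL
    -- Neumann again: the affine map defined on `D ⊇ L` is defined on all of the new coset `E₀`,
    -- which is closed, so no further extension is needed.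
    have hE₀D := hred.subset_of_subset hD hLD
    have hclosed : ∀ C ∈ cosetsOf {K : Subgroup H | IsClosed (K : Set H)}, IsClosed C := by
      rintro _ ⟨g, K, hK, rfl⟩
      exact IsClosed.smul hK g
    obtain ⟨hE₀, T, hT, hTE, rfl⟩ := hred
    have := hT.to_subtype
    have hcl : closure E₀ = E₀ := (hclosed _ hE₀).closure_eq
    refine ⟨E₀, Nat.card T, fun j => (Finite.equivFin T).symm j, ψ,
      ⟨isCoset_of_mem_cosetsOf hE₀, (hclosed _ hE₀).measurableSet⟩, fun j => ?_, ?_, ?_, ?_, hψ⟩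
    · have h := hTE _ ((Finite.equivFin T).symm j).2
      exact ⟨h.2, (hclosed _ h.1).measurableSet⟩
    · rw [(Finite.equivFin T).symm.surjective.iUnion_comp fun C : T => (C : Set H),
        ← Set.sUnion_eq_iUnion]
    · rw [hcl]
      exact hψc.mono hE₀D
    · rw [hcl]
      exact hψa.mono hE₀D
  choose E₀ m E ψ hE₀ hE hLE hψc hψa hψ using hpieces
  have := hQ.to_subtype
  let e := (Finite.equivFin Q).symm
  refine ⟨Nat.card Q, fun i => m (e i), fun i => E₀ (e i), fun i => E (e i), fun i => ψ (e i),
    fun i => hE₀ _, fun i => hE _, ?_, ?_, fun i => ⟨hψc _, hψa _, fun y hy => ?_⟩⟩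
  · intro i j hij
    simp only [Function.onFun, ← hLE]
    exact hQd (e i).2 (e j).2 fun h => hij (e.injective (Subtype.ext h))
  · simp only [← hLE]
    rw [e.surjective.iUnion_comp fun L : Q => (L : Set H), ← Set.sUnion_eq_iUnion, hQU]
  · rw [← hLE] at hy
    exact OnePoint.coe_injective (by rw [← hψ _ _ hy, hα])
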